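/- Let $n\ge 1$ and $p\ge 0$ be integers with $p<n-1$. Let $P$ be the joint distribution of a pair $(x,y)\in\mathbb R^p\times\mathbb R$ such that $x\sim N(0,\Sigma)$ with $\Sigma\in\mathbb R^{p\times p}$ an invertible covariance matrix, $f(x):=\mathbb E(y\mid x)=x^T\beta$ for some $\beta\in\mathbb R^p$, and the error $\epsilon=y-f(x)$ is square-integrable and independent of $x$; write $\sigma^2=\mathrm{Var}(y\mid x)$ for the constant conditional variance. No other assumption is made on the law of $\epsilon$. Let $(x_1,y_1),\dots,(x_n,y_n)$ be i.i.d. from $P$, let $X\in\mathbb R^{n\times p}$ have rows $x_i^T$ and let $Y=(y_1,\dots,y_n)$. Let $(x_0,y_0)$ be a further independent draw from $P$. Let $\tilde Y=(\tilde y_1,\dots,\tilde y_n)$ where, given $(X,Y)$, the $\tilde y_i$ are independent draws from the conditional laws of $y_i\mid x_i$. Let $\hat f_n(x)=x^T(X^TX)^{-1}X^TY$ be the least squares regression estimator (defined almost surely), and put $$\mathrm{ErrR}=\mathbb E_{X,Y,x_0,y_0}\big(y_0-\hat f_n(x_0)\big)^2,\qquad \mathrm{OptR}=\mathbb E_{X,Y,x_0,y_0}\Big[\big(y_0-\hat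 f_n(x_0)\big)^2-\big(y_1-\hat f_n(x_1)\big)^2\Big],$$ $$\mathrm{OptS}=\mathbb E_{X,Y,\tilde Y}\bigg[\frac1n\sum_{i=1}^n\big(\tilde y_i-\hat f_n(x_i)\big)^2-\frac1n\sum_{i=1}^n\big(y_i-\hat f_n(x_i)\big)^2\bigg].$$ Then the quantities inside these expectations are integrable, and $$\mathrm{OptR}=\mathrm{OptS}+\frac{\sigma^2p}{n}\,\frac{p+1}{n-p-1}=\frac{\sigma^2p}{n}\Big(2+\frac{p+1}{n-p-1}\Big).$$ Consequently, with $\mathrm{RSS}=\sum_{i=1}^n(y_i-\hat f_n(x_i))^2$, the criterion $$\mathrm{RCp}=\frac{\mathrm{RSS}}n+\frac{\sigma^2p}{n}\Big(2+\frac{p+1}{n-p-1}\Big)$$ is integrable and is an unbiased estimate of Random-X prediction error: $\mathbb E_{X,Y}\,\mathrm{RCp}=\mathrm{ErrR}$. -/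

import Mathlib

open MeasureTheory ProbabilityTheory
open scoped Matrix

noncomputable section

namespace RandomX

/-- Covariate space `ℝ^p`. -/
abbrev Cov (p : ℕ) : Type := EuclideanSpace ℝ (Fin p)

/-- A training set `(x_1, y_1), …, (x_n, y_n)`. -/
abbrev Data (n p : ℕ) : Type := Fin n → Cov p × ℝ

/-- A model building procedure: it turns training data into a prediction function. -/
abbrev Procedure (n p : ℕ) : Type := Data n p → Cov p → ℝ

/-- `P` is the joint law of a pair `(x, y)` with `y = f(x) + ε`, where `f(x) = E(y|x)`, the error
`ε = y - f(x)` is square-integrable and independent of `x`, and `Var(y|x) = σ²`. -/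
structure SignalPlusNoise {p : ℕ} (P : Measure (Cov p × ℝ)) (f : Cov p → ℝ) (σ : ℝ) : Prop where
  measurable_regression : Measurable f
  integrable_response : Integrable (fun z => z.2) P
  condExp_response :
    P[fun z => z.2 | MeasurableSpace.comap Prod.fst inferInstance] =ᵐ[P] fun z => f z.1
  memLp_error : MemLp (fun z => z.2 - f z.1) 2 P
  indep_error : IndepFun (fun z => z.2 - f z.1) Prod.fst P
  condVar_response :
    Var[fun z => z.2; P | MeasurableSpace.comap Prod.fst inferInstance] =ᵐ[P] fun _ => σ ^ 2

/-- The law of `(X, Y)`: `n` i.i.d. pairs from `P`. -/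
def trainLaw (n : ℕ) {p : ℕ} (P : Measure (Cov p × ℝ)) : Measure (Data n p) :=
  Measure.pi fun _ => P

/-- The law of `((X, Y), (x_0, y_0))`, with `(x_0, y_0)` an independent draw from `P`. -/
def trainTestLaw (n : ℕ) {p : ℕ} (P : Measure (Cov p × ℝ)) :
    Measure (Data n p × (Cov p × ℝ)) :=
  (trainLaw n P).prod P

/-- The law of `((x, y), ỹ)`, where `(x, y)` has law `P` and, given `(x, y)`, the variable `ỹ` is a
draw from the conditional law of the response given the covariate value `x`. -/
def copyLaw {p : ℕ} (P : Measure (Cov p × ℝ)) [IsFiniteMeasure P] : Measure ((Cov p × ℝ) × ℝ) :=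
  P ⊗ₘ (P.condKernel.comap Prod.fst measurable_fst)

/-- The law of `(X, Y, Ỹ)`, stored as `n` i.i.d. triples `((x_i, y_i), ỹ_i)`. -/
def sameXLaw (n : ℕ) {p : ℕ} (P : Measure (Cov p × ℝ)) [IsFiniteMeasure P] :
    Measure (Fin n → (Cov p × ℝ) × ℝ) :=
  Measure.pi fun _ => copyLaw P

/-- The squared prediction error at a new pair `(x_0, y_0)`. -/
def testError {n p : ℕ} (fhat : Procedure n p) (w : Data n p × (Cov p × ℝ)) : ℝ :=
  (w.2.2 - fhat w.1 w.2.1) ^ 2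

/-- Random-X prediction error `ErrR`. -/
def ErrR {n p : ℕ} (fhat : Procedure n p) (P : Measure (Cov p × ℝ)) : ℝ :=
  ∫ w, testError fhat w ∂trainTestLaw n P

/-- `(y_0 - fhat(x_0))² - (y_1 - fhat(x_1))²`; the first training pair has index `0` here. -/
def optRIntegrand {n p : ℕ} [NeZero n] (fhat : Procedure n p) (w : Data n p × (Cov p × ℝ)) : ℝ :=
  (w.2.2 - fhat w.1 w.2.1) ^ 2 - ((w.1 0).2 - fhat w.1 (w.1 0).1) ^ 2

/-- Random-X optimism `OptR`. -/
def OptR {n p : ℕ} [NeZero n] (fhat : Procedure n p) (P : Measure (Cov p × ℝ)) : ℝ :=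
  ∫ w, optRIntegrand fhat w ∂trainTestLaw n P

/-- `(1/n) ∑ (ỹ_i - fhat(x_i))² - (1/n) ∑ (y_i - fhat(x_i))²`, with `fhat` built from `(X, Y)`. -/
def optSIntegrand {n p : ℕ} (fhat : Procedure n p) (w : Fin n → (Cov p × ℝ) × ℝ) : ℝ :=
  (1 / (n : ℝ)) * ∑ i, ((w i).2 - fhat (fun k => (w k).1) (w i).1.1) ^ 2 -
    (1 / (n : ℝ)) * ∑ i, ((w i).1.2 - fhat (fun k => (w k).1) (w i).1.1) ^ 2

/-- Same-X optimism `OptS`. -/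
def OptS {n p : ℕ} (fhat : Procedure n p) (P : Measure (Cov p × ℝ)) [IsFiniteMeasure P] : ℝ :=
  ∫ w, optSIntegrand fhat w ∂sameXLaw n P

/-- The matrix `X` of training covariates, with `i`-th row `x_i`. -/
def designMatrix {n p : ℕ} (D : Data n p) : Matrix (Fin n) (Fin p) ℝ :=
  Matrix.of fun i j => (D i).1 j

/-- The vector `Y` of training responses. -/
def responses {n p : ℕ} (D : Data n p) : Fin n → ℝ := fun i => (D i).2

/-- Least squares regression of `Y` on `X`: `fhat(x) = xᵀ (Xᵀ X)⁻¹ Xᵀ Y`. -/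
def leastSquares {n p : ℕ} : Procedure n p := fun D x =>
  x.ofLp ⬝ᵥ (((designMatrix D)ᵀ * designMatrix D)⁻¹ *ᵥ ((designMatrix D)ᵀ *ᵥ responses D))

/-- Residual sum of squares `‖Y - fhat(X)‖₂²`. -/
def RSS {n p : ℕ} (fhat : Procedure n p) (D : Data n p) : ℝ :=
  ∑ i, ((D i).2 - fhat D (D i).1) ^ 2

/-- The `RCp` criterion of least squares, at known noise variance `σ²`. -/
def RCp {n p : ℕ} (σ : ℝ) (D : Data n p) : ℝ :=
  RSS leastSquares D / n + σ ^ 2 * p / n * (2 + ((p : ℝ) + 1) / ((n : ℝ) - p - 1))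

end RandomX

end

namespace RandomX

/-! Least squares predicts with weights `weight xs x` that depend on the covariates alone. When the
Gram matrix G = XᵀX is invertible, these weights reproduce linear functions. The signal therefore
cancels from every prediction error (`sub_leastSquares_eq`), which becomes a linear combination of
centred i.i.d. errors with coefficients independent of them. Its second moment is σ² times the mean
sum of squared coefficients (`integral_sq_sum_mul_noise`), so only the variance of the error law
matters.

With H = XG⁻¹Xᵀ, a symmetric idempotent of trace p, that sum is 1 - Hᵢᵢ for a training residual and
1 + Hᵢᵢ for a fresh response at xᵢ. By exchangeability E Hᵢᵢ = p/n. Hence E RSS/n = σ²(1 - p/n) and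
OptS = 2σ²p/n.

At an independent x₀ the sum is 1 + x₀ᵀG⁻¹x₀. Whitening reduces to Σ = I (`weight_linear`), where
the mean of the quadratic form is ∑ⱼ E (G⁻¹)ⱼⱼ. Now 1/(G⁻¹)ⱼⱼ is the squared distance from the j-th
column of X to the span of the others (`gram_inv_apply_self_mul_norm_sq`). It is chi-squared with n
- p + 1 degrees of freedom, so its inverse has mean 1/(n - p - 1). Thus ErrR = σ²(1 + p/(n - p -
1)), and the claims follow from n/(n - p - 1) = 1 + (p + 1)/(n - p - 1). -/

/-! ### Inverse moment of the chi-squared law. -/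

lemma integral_exp_neg_mul_sq_gaussianReal {t : ℝ} (ht : 0 < t) :
    ∫ x, Real.exp (-t * x ^ 2) ∂(gaussianReal 0 1) = (√(1 + 2 * t))⁻¹ := by
  rw [integral_gaussianReal_eq_integral_smul one_ne_zero]
  have h : ∀ x : ℝ, gaussianPDFReal 0 1 x • Real.exp (-t * x ^ 2) =
      (√(2 * Real.pi))⁻¹ * Real.exp (-(t + 1 / 2) * x ^ 2) := by
    intro x
    rw [gaussianPDFReal, smul_eq_mul, mul_assoc, ← Real.exp_add]
    simp only [NNReal.coe_one, mul_one, sub_zero]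
    congr 2
    ring
  simp_rw [h]
  rw [integral_const_mul, integral_gaussian, ← Real.sqrt_inv, ← Real.sqrt_inv,
    ← Real.sqrt_mul (by positivity)]
  congr 1
  have := Real.pi_pos
  field_simp
  ring

lemma lintegral_exp_neg_mul_norm_sq_stdGaussian {W : Type*} [NormedAddCommGroup W]
    [InnerProductSpace ℝ W] [FiniteDimensional ℝ W] [MeasurableSpace W] [BorelSpace W]
    {t : ℝ} (ht : 0 < t) :
    ∫⁻ w, ENNReal.ofReal (Real.exp (-t * ‖w‖ ^ 2)) ∂(stdGaussian W) =
      ENNReal.ofReal ((1 + 2 * t) ^ (-(Module.finrank ℝ W : ℝ) / 2)) := by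
  have hn : ∀ x : Fin (Module.finrank ℝ W) → ℝ,
      ‖∑ i, x i • stdOrthonormalBasis ℝ W i‖ ^ 2 = ∑ i, x i ^ 2 := by
    intro x
    rw [← (stdOrthonormalBasis ℝ W).sum_sq_inner_right]
    refine Finset.sum_congr rfl fun i _ => ?_
    rw [(stdOrthonormalBasis ℝ W).orthonormal.inner_right_fintype]
  rw [← ofReal_integral_eq_lintegral_ofReal]
  · congr 1
    rw [stdGaussian, integral_map (Measurable.aemeasurable (by fun_prop)) (by fun_prop)]
    simp_rw [hn, Finset.mul_sum, Real.exp_sum]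
    rw [integral_fintype_prod_eq_pow (fun x : ℝ => Real.exp (-t * x ^ 2)),
      integral_exp_neg_mul_sq_gaussianReal ht, Fintype.card_fin, Real.sqrt_eq_rpow,
      ← Real.rpow_neg (by positivity), ← Real.rpow_natCast, ← Real.rpow_mul (by positivity)]
    congr 1
    ring
  · refine Integrable.of_bound (by fun_prop) 1 (ae_of_all _ fun w => ?_)
    rw [Real.norm_eq_abs, abs_of_pos (Real.exp_pos _), Real.exp_le_one_iff]
    nlinarith [sq_nonneg ‖w‖]
  · exact ae_of_all _ fun w => (Real.exp_pos _).le

/-- Expresses 1/r through Laplace transforms. At r = 0 both sides are infinite, so no null set has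
to be removed. -/
lemma lintegral_exp_neg_mul_Ioi {r : ℝ} (hr : 0 ≤ r) :
    ∫⁻ t in Set.Ioi (0 : ℝ), ENNReal.ofReal (Real.exp (-t * r)) = (ENNReal.ofReal r)⁻¹ := by
  rcases hr.eq_or_lt with rfl | hr
  · simp
  · have h : ∀ t : ℝ, Real.exp (-t * r) = Real.exp (-r * t) := fun t => by ring_nf
    simp_rw [h]
    rw [← ofReal_integral_eq_lintegral_ofReal (integrableOn_exp_mul_Ioi (by linarith) 0)
      (ae_of_all _ fun w => (Real.exp_pos _).le), integral_exp_mul_Ioi (by linarith),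
      ← ENNReal.ofReal_inv_of_pos hr]
    congr 1
    simp


lemma lintegral_one_add_two_mul_rpow_Ioi {m : ℝ} (hm : 2 < m) :
    ∫⁻ t in Set.Ioi (0 : ℝ), ENNReal.ofReal ((1 + 2 * t) ^ (-m / 2)) =
      ENNReal.ofReal (1 / (m - 2)) := by
  have hd : ∀ t ∈ Set.Ici (0 : ℝ), HasDerivAt (fun t : ℝ => -(1 + 2 * t) ^ (1 - m / 2) / (m - 2))
      ((1 + 2 * t) ^ (-m / 2)) t := by
    intro t ht
    have ht : 0 ≤ t := ht
    have h1 : HasDerivAt (fun t : ℝ => 1 + 2 * t) 2 t := by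
      simpa using ((hasDerivAt_id t).const_mul 2).const_add 1
    have h2 := ((h1.rpow_const (p := 1 - m / 2) (Or.inl (by positivity))).neg).div_const (m - 2)
    refine h2.congr_deriv ?_
    rw [show (1 - m / 2 - 1) = -m / 2 by ring]
    have : m - 2 ≠ 0 := by linarith
    field_simp
    ring
  have hlim : Filter.Tendsto (fun t : ℝ => -(1 + 2 * t) ^ (1 - m / 2) / (m - 2)) Filter.atTop
      (nhds 0) := by
    have h1 : Filter.Tendsto (fun t : ℝ => 1 + 2 * t) Filter.atTop Filter.atTop :=
      Filter.tendsto_atTop_add_const_left _ _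
        (Filter.tendsto_id.const_mul_atTop (by norm_num))
    have h2 := ((tendsto_rpow_neg_atTop (y := m / 2 - 1) (by linarith)).comp h1).neg.div_const
      (m - 2)
    simpa [Function.comp_def] using h2
  have hpos : ∀ t ∈ Set.Ioi (0 : ℝ), 0 ≤ (1 + 2 * t) ^ (-m / 2) := fun t ht => by
    have : 0 < t := ht
    positivity
  rw [← ofReal_integral_eq_lintegral_ofReal
    (integrableOn_Ioi_deriv_of_nonneg' hd hpos hlim)
    ((ae_restrict_iff' measurableSet_Ioi).2 (ae_of_all _ hpos)),
    integral_Ioi_of_hasDerivAt_of_nonneg' hd hpos hlim]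
  congr 1
  simp [neg_div]

/-- The mean of an inverse chi-squared variable with `m > 2` degrees of freedom is
`1 / (m - 2)`. -/
lemma lintegral_inv_norm_sq_stdGaussian {W : Type*} [NormedAddCommGroup W]
    [InnerProductSpace ℝ W] [FiniteDimensional ℝ W] [MeasurableSpace W] [BorelSpace W]
    (hW : 2 < Module.finrank ℝ W) :
    ∫⁻ w, (ENNReal.ofReal (‖w‖ ^ 2))⁻¹ ∂(stdGaussian W) =
      ENNReal.ofReal (1 / ((Module.finrank ℝ W : ℝ) - 2)) := by
  have hW' : (2 : ℝ) < Module.finrank ℝ W := by exact_mod_cast hW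
  -- Tonelli turns the inverse moment into the integral over t of the Laplace transform of ‖w‖²,
  -- which is (1 + 2t)^(-m/2).
  simp_rw [← lintegral_exp_neg_mul_Ioi (sq_nonneg _)]
  rw [lintegral_lintegral_swap (by fun_prop), ← lintegral_one_add_two_mul_rpow_Ioi hW']
  exact setLIntegral_congr_fun measurableSet_Ioi fun t ht =>
    lintegral_exp_neg_mul_norm_sq_stdGaussian ht

/-- The projection is adjoint to the isometric inclusion, so the characteristic functions agree. -/
lemma stdGaussian_map_orthogonalProjection {E : Type*} [NormedAddCommGroup E]
    [InnerProductSpace ℝ E] [FiniteDimensional ℝ E] [MeasurableSpace E] [BorelSpace E]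
    (V : Submodule ℝ E) :
    (stdGaussian E).map V.orthogonalProjectionOnto = stdGaussian V := by
  apply Measure.ext_of_charFun
  ext t
  rw [charFun_stdGaussian, charFun_apply, integral_map (by fun_prop) (by fun_prop)]
  have : ∀ x : E, inner ℝ (V.orthogonalProjectionOnto x) t = inner ℝ x (t : E) := fun x => by
    rw [Submodule.inner_orthogonalProjectionOnto_eq_of_mem_right]
  simp_rw [this]
  rw [← charFun_apply, charFun_stdGaussian]
  simp

/-! ### Gram matrices, distances to spans and almost sure independence. -/

section Gram

variable {E : Type*} [NormedAddCommGroup E] [InnerProductSpace ℝ E] [FiniteDimensional ℝ E]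

lemma gram_inv_apply_self_mul_norm_sq {q : ℕ} {z : Fin (q + 1) → E}
    (hz : IsUnit (Matrix.gram ℝ z)) (j : Fin (q + 1)) :
    (Matrix.gram ℝ z)⁻¹ j j *
      ‖(Submodule.span ℝ (Set.range (j.removeNth z)))ᗮ.orthogonalProjectionOnto (z j)‖ ^ 2 = 1 := by
  set V := Submodule.span ℝ (Set.range (j.removeNth z))
  set B := (Matrix.gram ℝ z)⁻¹
  -- The dual vector: ⟨zᵢ, w⟩ = δᵢⱼ. It lies in Vᗮ, so projecting its expansion onto Vᗮ leaves only
  -- the `j`-th term; pairing with `z j` gives the identity.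
  set w : E := ∑ k, B k j • z k
  have hdet := (Matrix.isUnit_iff_isUnit_det _).1 hz
  have hzw : ∀ i, inner ℝ (z i) w = (1 : Matrix (Fin (q + 1)) (Fin (q + 1)) ℝ) i j := by
    intro i
    rw [← Matrix.mul_nonsing_inv _ hdet, Matrix.mul_apply, inner_sum]
    refine Finset.sum_congr rfl fun k _ => ?_
    rw [inner_smul_right, Matrix.gram_apply, mul_comm]
  have hwV : w ∈ Vᗮ := by
    rw [Submodule.mem_orthogonal]
    intro u hu
    induction hu using Submodule.span_induction with
    | mem x hx =>
      obtain ⟨i, rfl⟩ := hx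
      rw [Fin.removeNth_apply, hzw, Matrix.one_apply_ne (Fin.succAbove_ne j i)]
    | zero => simp
    | add x y _ _ hx hy => rw [inner_add_left, hx, hy, add_zero]
    | smul a x _ hx => rw [inner_smul_left, hx, mul_zero]
  have hproj : w = B j j • (Vᗮ.orthogonalProjectionOnto (z j) : E) := by
    have h1 : (Vᗮ.orthogonalProjectionOnto w : E) = w :=
      Submodule.starProjection_eq_self_iff.2 hwV
    rw [← h1]
    simp only [w, map_sum, map_smul]
    rw [Fin.sum_univ_succAbove _ j]
    rw [Finset.sum_eq_zero, add_zero, Submodule.coe_smul]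
    intro i _
    rw [Submodule.orthogonalProjectionOnto_orthogonal_apply_eq_zero, smul_zero]
    exact Submodule.subset_span ⟨i, rfl⟩
  have h2 : inner ℝ (z j) w = inner ℝ (Vᗮ.orthogonalProjectionOnto (z j) : E) w :=
    (Submodule.inner_orthogonalProjectionOnto_eq_of_mem_right ⟨w, hwV⟩ (z j)).symm
  rw [hzw, Matrix.one_apply_eq, hproj, inner_smul_right, real_inner_self_eq_norm_sq] at h2
  rw [h2]
  rfl

variable [MeasurableSpace E] [BorelSpace E]

lemma lintegral_inv_norm_sq_orthogonalProjection_span {q : ℕ}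
    (hq : q + 3 ≤ Module.finrank ℝ E) {b : Fin q → E} (hb : LinearIndependent ℝ b) :
    ∫⁻ a, (ENNReal.ofReal
        (‖(Submodule.span ℝ (Set.range b))ᗮ.orthogonalProjectionOnto a‖ ^ 2))⁻¹ ∂(stdGaussian E) =
      ENNReal.ofReal (1 / ((Module.finrank ℝ E : ℝ) - q - 2)) := by
  set V := Submodule.span ℝ (Set.range b)
  have hV : Module.finrank ℝ V = q := by simpa using finrank_span_eq_card hb
  have hV' := V.finrank_add_finrank_orthogonal
  have hcast : (Module.finrank ℝ Vᗮ : ℝ) = (Module.finrank ℝ E : ℝ) - q := by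
    rw [← hV', hV]; push_cast; ring
  rw [← hcast, ← lintegral_inv_norm_sq_stdGaussian (by omega),
    ← stdGaussian_map_orthogonalProjection Vᗮ, lintegral_map (by fun_prop) (by fun_prop)]

/-- On the span the distance vanishes and its inverse square is `⊤`; a finite integral makes this a
null event. -/
lemma ae_notMem_span_stdGaussian {q : ℕ}
    (hq : q + 3 ≤ Module.finrank ℝ E) {b : Fin q → E} (hb : LinearIndependent ℝ b) :
    ∀ᵐ a ∂(stdGaussian E), a ∉ Submodule.span ℝ (Set.range b) := by
  have h := lintegral_inv_norm_sq_orthogonalProjection_span hq hb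
  have h2 := ae_lt_top (by fun_prop) (h.trans_ne ENNReal.ofReal_ne_top)
  filter_upwards [h2] with a ha hmem
  rw [Submodule.orthogonalProjectionOnto_orthogonal_apply_eq_zero hmem] at ha
  simp at ha

lemma ae_linearIndependent_pi_stdGaussian {q : ℕ} (hq : q + 2 ≤ Module.finrank ℝ E) :
    ∀ᵐ z ∂(Measure.pi fun _ : Fin q => stdGaussian E), LinearIndependent ℝ z := by
  induction q with
  | zero => exact ae_of_all _ fun z => linearIndependent_empty_type
  | succ q ih =>
    have hmp := (measurePreserving_piFinSuccAbove (fun _ : Fin (q + 1) => stdGaussian E) 0).symm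
    rw [← hmp.map_eq, ae_map_iff hmp.measurable.aemeasurable
      isOpen_setOfPred_linearIndependent.measurableSet]
    have hms : MeasurableSet {x : E × (Fin q → E) | LinearIndependent ℝ
        ((MeasurableEquiv.piFinSuccAbove (fun _ : Fin (q + 1) => E) 0).symm x)} :=
      hmp.measurable isOpen_setOfPred_linearIndependent.measurableSet
    rw [Measure.ae_prod_iff_ae_ae hms, Measure.ae_ae_comm hms]
    filter_upwards [ih (by omega)] with b hb
    filter_upwards [ae_notMem_span_stdGaussian (by omega) hb] with a ha
    have hsymm : (MeasurableEquiv.piFinSuccAbove (fun _ : Fin (q + 1) => E) 0).symm (a, b) =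
        Fin.cons a b := Fin.insertNth_zero' a b
    rw [hsymm]
    exact linearIndependent_finCons.2 ⟨hb, ha⟩

end Gram

/-- The adjugate formula also covers singular matrices, since the inverse of a zero determinant is
zero. -/
lemma measurable_matrix_inv_apply {Ω ι : Type*} [MeasurableSpace Ω] [Fintype ι] [DecidableEq ι]
    {A : Ω → Matrix ι ι ℝ} (hA : ∀ i j, Measurable fun ω => A ω i j) (i j : ι) :
    Measurable fun ω => (A ω)⁻¹ i j := by
  have hdet : ∀ B : Ω → Matrix ι ι ℝ, (∀ i j, Measurable fun ω => B ω i j) →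
      Measurable fun ω => (B ω).det := by
    intro B hB
    simp_rw [Matrix.det_apply]
    exact Finset.measurable_sum _ fun τ _ =>
      (Finset.measurable_prod _ fun k _ => hB _ _).const_smul _
  simp_rw [Matrix.inv_def, Ring.inverse_eq_inv', Matrix.smul_apply, smul_eq_mul,
    Matrix.adjugate_apply]
  refine (hdet _ hA).inv.mul (hdet _ fun k l => ?_)
  by_cases hk : k = j
  · subst hk
    simp
  · simpa [Matrix.updateRow_ne hk] using hA k l

/-! ### Mean diagonal of the inverse Gram matrix. -/

section GramMoment

variable {E : Type*} [NormedAddCommGroup E] [InnerProductSpace ℝ E] [FiniteDimensional ℝ E]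
  [MeasurableSpace E] [BorelSpace E]

lemma measurable_gram_inv_apply {ι : Type*} [Fintype ι] [DecidableEq ι] (i j : ι) :
    Measurable fun z : ι → E => (Matrix.gram ℝ z)⁻¹ i j :=
  measurable_matrix_inv_apply (fun i j => by simp only [Matrix.gram_apply]; fun_prop) i j

lemma ae_isUnit_gram {k : ℕ} (hk : k + 2 ≤ Module.finrank ℝ E) :
    ∀ᵐ z ∂(Measure.pi fun _ : Fin k => stdGaussian E), IsUnit (Matrix.gram ℝ z) := by
  filter_upwards [ae_linearIndependent_pi_stdGaussian hk] with z hz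
  exact (Matrix.posDef_gram_of_linearIndependent hz).isUnit

lemma lintegral_gram_inv_apply_self {k : ℕ} (hk : k + 2 ≤ Module.finrank ℝ E) (j : Fin k) :
    ∫⁻ z, ENNReal.ofReal ((Matrix.gram ℝ z)⁻¹ j j) ∂(Measure.pi fun _ : Fin k => stdGaussian E) =
      ENNReal.ofReal (1 / ((Module.finrank ℝ E : ℝ) - k - 1)) := by
  obtain _ | q := k
  · exact j.elim0
  have hmp := measurePreserving_piFinSuccAbove (fun _ : Fin (q + 1) => stdGaussian E) j
  have hae := hmp.symm.quasiMeasurePreserving.ae (ae_isUnit_gram hk)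
  have hm : Measurable fun x : E × (Fin q → E) => ENNReal.ofReal ((Matrix.gram ℝ
      ((MeasurableEquiv.piFinSuccAbove (fun _ : Fin (q + 1) => E) j).symm x))⁻¹ j j) :=
    ((measurable_gram_inv_apply j j).comp (MeasurableEquiv.measurable _)).ennreal_ofReal
  rw [← hmp.symm.lintegral_comp_emb (MeasurableEquiv.measurableEmbedding _),
    lintegral_prod_symm' _ hm]
  -- With the other vectors fixed, only the distance of the `j`-th one to their span is random, and
  -- its inverse second moment does not depend on `b`.
  have hinner : ∀ᵐ b ∂(Measure.pi fun _ : Fin q => stdGaussian E),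
      ∫⁻ a, ENNReal.ofReal ((Matrix.gram ℝ
        ((MeasurableEquiv.piFinSuccAbove (fun _ : Fin (q + 1) => E) j).symm (a, b)))⁻¹ j j)
        ∂(stdGaussian E) = ENNReal.ofReal (1 / ((Module.finrank ℝ E : ℝ) - q - 2)) := by
    have hae' := Measure.ae_ae_of_ae_prod
      (Measure.measurePreserving_swap.quasiMeasurePreserving.ae hae)
    filter_upwards [hae', ae_linearIndependent_pi_stdGaussian (q := q) (by omega)] with b hb hbl
    rw [← lintegral_inv_norm_sq_orthogonalProjection_span (by omega) hbl]
    refine lintegral_congr_ae ?_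
    filter_upwards [hb] with a ha
    have hsymm : (MeasurableEquiv.piFinSuccAbove (fun _ : Fin (q + 1) => E) j).symm (a, b) =
        j.insertNth a b := rfl
    rw [Prod.swap_prod_mk, hsymm] at ha
    have h := gram_inv_apply_self_mul_norm_sq ha j
    rw [Fin.insertNth_apply_same, Fin.removeNth_insertNth] at h
    rw [hsymm, eq_inv_of_mul_eq_one_left h]
    rw [ENNReal.ofReal_inv_of_pos]
    exact (sq_nonneg _).lt_of_ne' fun h0 => by rw [h0, mul_zero] at h; exact zero_ne_one h
  rw [lintegral_congr_ae hinner, lintegral_const, measure_univ, mul_one]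
  congr 2
  push_cast
  ring

end GramMoment

/-! ### Second moments of linear forms in the noise. -/

lemma integral_mul_pi_eval {ι : Type*} [Fintype ι] [DecidableEq ι] {ν : Measure ℝ}
    [IsProbabilityMeasure ν] (h0 : ∫ x, x ∂ν = 0) (i j : ι) :
    ∫ e : ι → ℝ, e i * e j ∂(Measure.pi fun _ => ν) = if i = j then ∫ x, x ^ 2 ∂ν else 0 := by
  split_ifs with hij
  · subst hij
    simp_rw [← sq]
    exact integral_comp_eval (μ := fun _ : ι => ν) (f := fun x : ℝ => x ^ 2) (by fun_prop)
  · have hind : IndepFun (fun e : ι → ℝ => e i) (fun e => e j) (Measure.pi fun _ => ν) :=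
      (iIndepFun_pi (μ := fun _ : ι => ν) (X := fun _ x => x)
        (fun _ => aemeasurable_id)).indepFun hij
    rw [hind.integral_fun_mul_eq_mul_integral
      (measurable_pi_apply i).aestronglyMeasurable (measurable_pi_apply j).aestronglyMeasurable,
      integral_comp_eval (μ := fun _ : ι => ν) (f := fun x : ℝ => x) (by fun_prop), h0, zero_mul]

/-- Second moment of a linear combination of centred i.i.d. noise variables, with random
coefficients that are independent of the noise. -/
lemma integral_sq_sum_mul_noise {𝓦 ι : Type*} [MeasurableSpace 𝓦] [Fintype ι] {ρ : Measure 𝓦}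
    [SFinite ρ] {ν : Measure ℝ} [IsProbabilityMeasure ν] (h2 : MemLp id 2 ν)
    (h0 : ∫ x, x ∂ν = 0) {c : ι → 𝓦 → ℝ} (hc : ∀ i, MemLp (c i) 2 ρ) :
    Integrable (fun w : 𝓦 × (ι → ℝ) => (∑ i, c i w.1 * w.2 i) ^ 2)
      (ρ.prod (Measure.pi fun _ => ν)) ∧
    ∫ w, (∑ i, c i w.1 * w.2 i) ^ 2 ∂(ρ.prod (Measure.pi fun _ => ν)) =
      (∫ x, x ^ 2 ∂ν) * ∫ w, ∑ i, c i w ^ 2 ∂ρ := by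
  classical
  have hexp : ∀ w : 𝓦 × (ι → ℝ), (∑ i, c i w.1 * w.2 i) ^ 2 =
      ∑ i, ∑ j, (c i w.1 * c j w.1) * (w.2 i * w.2 j) := fun w => by
    rw [sq, Finset.sum_mul_sum]
    exact Finset.sum_congr rfl fun i _ => Finset.sum_congr rfl fun j _ => by ring
  have heval : ∀ i : ι, MemLp (fun e : ι → ℝ => e i) 2 (Measure.pi fun _ => ν) := fun i =>
    h2.comp_measurePreserving (measurePreserving_eval (fun _ : ι => ν) i)
  have hint : ∀ i j, Integrable (fun w : 𝓦 × (ι → ℝ) => (c i w.1 * c j w.1) * (w.2 i * w.2 j))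
      (ρ.prod (Measure.pi fun _ => ν)) := fun i j =>
    -- Each factor is a product of two L² functions on its own space, so no fourth moment is needed.
    ((hc i).integrable_mul (hc j)).mul_prod ((heval i).integrable_mul (heval j))
  simp_rw [hexp]
  refine ⟨integrable_finsetSum _ fun i _ => integrable_finsetSum _ fun j _ => hint i j, ?_⟩
  rw [integral_finsetSum _ fun i _ => integrable_finsetSum _ fun j _ => hint i j,
    integral_finsetSum _ fun i _ => (hc i).integrable_sq, Finset.mul_sum]
  refine Finset.sum_congr rfl fun i _ => ?_
  rw [integral_finsetSum _ fun j _ => hint i j]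
  have hij : ∀ j, ∫ w : 𝓦 × (ι → ℝ), (c i w.1 * c j w.1) * (w.2 i * w.2 j)
      ∂(ρ.prod (Measure.pi fun _ => ν)) =
      (∫ w, c i w * c j w ∂ρ) * if i = j then ∫ x, x ^ 2 ∂ν else 0 := fun j => by
    rw [integral_prod_mul (fun w => c i w * c j w) (fun e : ι → ℝ => e i * e j),
      integral_mul_pi_eval h0]
  simp_rw [hij]
  simp [mul_comm, sq]

/-! ### From rows to columns of the design. -/

/-- The design matrix as a function of the covariates alone. -/
noncomputable def covMatrix {n p : ℕ} (xs : Fin n → Cov p) : Matrix (Fin n) (Fin p) ℝ :=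
  Matrix.of fun i j => xs i j

/-- The columns of the design matrix. -/
noncomputable def columns {n p : ℕ} (xs : Fin n → Cov p) : Fin p → EuclideanSpace ℝ (Fin n) :=
  fun j => WithLp.toLp 2 fun i => xs i j

lemma gram_columns {n p : ℕ} (xs : Fin n → Cov p) :
    Matrix.gram ℝ (columns xs) = (covMatrix xs)ᵀ * covMatrix xs := by
  ext i j
  simp [Matrix.gram_apply, columns, covMatrix, Matrix.mul_apply, PiLp.inner_apply, mul_comm]

lemma measurePreserving_transpose_pi {ι κ X : Type*} [Fintype ι] [Fintype κ] [MeasurableSpace X]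
    (μ : Measure X) [IsProbabilityMeasure μ] :
    MeasurePreserving (fun (y : ι → κ → X) j i => y i j)
      (Measure.pi fun _ => Measure.pi fun _ => μ) (Measure.pi fun _ => Measure.pi fun _ => μ) := by
  have h1 : (Measure.pi fun _ : ι => Measure.pi fun _ : κ => μ) =
      (Measure.infinitePi fun _ : ι × κ => μ).map (MeasurableEquiv.curry ι κ X) := by
    simp_rw [← Measure.infinitePi_eq_pi]
    exact (Measure.infinitePi_map_curry fun _ _ => μ).symm
  have h2 : (Measure.pi fun _ : κ => Measure.pi fun _ : ι => μ) =
      (Measure.infinitePi fun _ : κ × ι => μ).map (MeasurableEquiv.curry κ ι X) := by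
    simp_rw [← Measure.infinitePi_eq_pi]
    exact (Measure.infinitePi_map_curry fun _ _ => μ).symm
  have h3 := Measure.infinitePi_map_piCongrLeft (fun _ : κ × ι => μ) (Equiv.prodComm ι κ)
  refine ⟨by fun_prop, ?_⟩
  rw [h1, h2, ← h3, Measure.map_map (by fun_prop) (by fun_prop),
    Measure.map_map (by fun_prop) (by fun_prop)]
  congr 1

/-- All entries are i.i.d. standard normal, so rows and columns can be exchanged. The Gram results
apply to the `p` columns in ℝⁿ. -/
lemma measurePreserving_columns (n p : ℕ) :
    MeasurePreserving (columns (n := n) (p := p)) (Measure.pi fun _ => stdGaussian (Cov p))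
      (Measure.pi fun _ => stdGaussian (EuclideanSpace ℝ (Fin n))) := by
  have hlp : ∀ m : ℕ, MeasurePreserving (WithLp.toLp 2 : (Fin m → ℝ) → EuclideanSpace ℝ (Fin m))
      (Measure.pi fun _ => gaussianReal 0 1) (stdGaussian (EuclideanSpace ℝ (Fin m))) :=
    fun m => ⟨by fun_prop, map_pi_eq_stdGaussian⟩
  have hpi : ∀ m k : ℕ, MeasurePreserving
      (fun (y : Fin k → Fin m → ℝ) i => (WithLp.toLp 2 (y i) : EuclideanSpace ℝ (Fin m)))
      (Measure.pi fun _ => Measure.pi fun _ => gaussianReal 0 1)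
      (Measure.pi fun _ => stdGaussian (EuclideanSpace ℝ (Fin m))) :=
    fun m k => measurePreserving_pi _ _ fun _ => hlp m
  have h := (hpi n p).comp (measurePreserving_transpose_pi (ι := Fin n) (κ := Fin p)
    (gaussianReal 0 1))
  refine ⟨by unfold columns; fun_prop, ?_⟩
  rw [← h.map_eq, ← (hpi p n).map_eq, Measure.map_map (by unfold columns; fun_prop) (by fun_prop)]
  rfl

/-- The weights which least squares puts on the training responses when predicting at `x`. -/
noncomputable def weight {n p : ℕ} (xs : Fin n → Cov p) (x : Cov p) : Fin n → ℝ :=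
  covMatrix xs *ᵥ (((covMatrix xs)ᵀ * covMatrix xs)⁻¹ *ᵥ x.ofLp)

lemma measurable_mul_gram_inv {n p : ℕ} (i : Fin n) (j : Fin p) :
    Measurable fun xs : Fin n → Cov p =>
      (covMatrix xs * ((covMatrix xs)ᵀ * covMatrix xs)⁻¹) i j := by
  simp_rw [Matrix.mul_apply (M := covMatrix _)]
  refine Finset.measurable_sum _ fun k _ => Measurable.mul ?_
    (measurable_matrix_inv_apply (fun a b => ?_) _ _)
  · simp only [covMatrix, Matrix.of_apply]; fun_prop
  · simp only [covMatrix, Matrix.mul_apply, Matrix.transpose_apply, Matrix.of_apply]; fun_prop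

lemma weight_apply {n p : ℕ} (xs : Fin n → Cov p) (x : Cov p) (i : Fin n) :
    weight xs x i =
      ∑ j, (covMatrix xs * ((covMatrix xs)ᵀ * covMatrix xs)⁻¹) i j * x.ofLp j := by
  rw [weight, Matrix.mulVec_mulVec]
  rfl

lemma measurable_weight {n p : ℕ} (i : Fin n) :
    Measurable fun w : (Fin n → Cov p) × Cov p => weight w.1 w.2 i := by
  simp_rw [weight_apply]
  exact Finset.measurable_sum _ fun j _ =>
    ((measurable_mul_gram_inv i j).comp measurable_fst).mul (by fun_prop)

/-! ### Mean squared weights for standard Gaussian covariates. -/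

section Standard

variable {n p : ℕ}

lemma integrable_gram_inv_stdGaussian (hnp : p + 1 < n) (j : Fin p) :
    Integrable (fun xs : Fin n → Cov p => ((covMatrix xs)ᵀ * covMatrix xs)⁻¹ j j)
      (Measure.pi fun _ => stdGaussian (Cov p)) ∧
    ∫ xs : Fin n → Cov p, ((covMatrix xs)ᵀ * covMatrix xs)⁻¹ j j
      ∂(Measure.pi fun _ => stdGaussian (Cov p)) = 1 / ((n : ℝ) - p - 1) := by
  have hm := measurable_gram_inv_apply (E := EuclideanSpace ℝ (Fin n)) j j
  have hmp := measurePreserving_columns n p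
  have hl := lintegral_gram_inv_apply_self (E := EuclideanSpace ℝ (Fin n)) (k := p)
    (by rw [finrank_euclideanSpace_fin]; omega) j
  rw [finrank_euclideanSpace_fin, ← hmp.lintegral_comp hm.ennreal_ofReal] at hl
  simp_rw [gram_columns] at hl
  have hm' : Measurable fun xs : Fin n → Cov p => ((covMatrix xs)ᵀ * covMatrix xs)⁻¹ j j := by
    simp_rw [← gram_columns]
    exact hm.comp hmp.measurable
  have hpos : ∀ xs : Fin n → Cov p, 0 ≤ ((covMatrix xs)ᵀ * covMatrix xs)⁻¹ j j := fun xs => by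
    rw [← gram_columns]
    exact (Matrix.posSemidef_gram ℝ (columns xs)).inv.diag_nonneg
  have hnn : 0 ≤ 1 / ((n : ℝ) - p - 1) := by
    have : (p : ℝ) + 1 < n := by exact_mod_cast hnp
    exact div_nonneg zero_le_one (by linarith)
  refine ⟨⟨hm'.aestronglyMeasurable, ?_⟩, ?_⟩
  · rw [hasFiniteIntegral_iff_ofReal (ae_of_all _ hpos), hl]
    exact ENNReal.ofReal_lt_top
  · rw [integral_eq_lintegral_of_nonneg_ae (ae_of_all _ hpos) hm'.aestronglyMeasurable, hl,
      ENNReal.toReal_ofReal hnn]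

lemma ae_isUnit_gram_stdGaussian (hnp : p + 1 < n) :
    ∀ᵐ xs : Fin n → Cov p ∂(Measure.pi fun _ => stdGaussian (Cov p)),
      IsUnit ((covMatrix xs)ᵀ * covMatrix xs) := by
  simp_rw [← gram_columns]
  exact (measurePreserving_columns n p).quasiMeasurePreserving.ae
    (ae_isUnit_gram (by rw [finrank_euclideanSpace_fin]; omega))

lemma sum_sq_mul_gram_inv {X : Matrix (Fin n) (Fin p) ℝ} (hX : IsUnit (Xᵀ * X)) (j : Fin p) :
    ∑ i, (X * (Xᵀ * X)⁻¹) i j ^ 2 = (Xᵀ * X)⁻¹ j j := by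
  have h : (X * (Xᵀ * X)⁻¹)ᵀ * (X * (Xᵀ * X)⁻¹) = (Xᵀ * X)⁻¹ := by
    rw [Matrix.transpose_mul, Matrix.transpose_nonsing_inv, Matrix.transpose_mul,
      Matrix.transpose_transpose, Matrix.mul_assoc, ← Matrix.mul_assoc Xᵀ,
      Matrix.mul_nonsing_inv _ ((Matrix.isUnit_iff_isUnit_det _).1 hX), Matrix.mul_one]
  conv_rhs => rw [← h, Matrix.mul_apply]
  simp only [Matrix.transpose_apply, sq]

lemma memLp_mul_gram_inv_stdGaussian (hnp : p + 1 < n) (i : Fin n) (j : Fin p) :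
    MemLp (fun xs : Fin n → Cov p => (covMatrix xs * ((covMatrix xs)ᵀ * covMatrix xs)⁻¹) i j) 2
      (Measure.pi fun _ => stdGaussian (Cov p)) := by
  rw [memLp_two_iff_integrable_sq (measurable_mul_gram_inv i j).aestronglyMeasurable]
  refine (integrable_gram_inv_stdGaussian hnp j).1.mono'
    ((measurable_mul_gram_inv i j).pow_const 2).aestronglyMeasurable ?_
  filter_upwards [ae_isUnit_gram_stdGaussian hnp] with xs hxs
  rw [Real.norm_of_nonneg (sq_nonneg _), ← sum_sq_mul_gram_inv hxs]
  exact Finset.single_le_sum (f := fun i => (covMatrix xs * ((covMatrix xs)ᵀ * covMatrix xs)⁻¹) i j ^ 2)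
    (fun _ _ => sq_nonneg _) (Finset.mem_univ i)

lemma weight_stdGaussian (hnp : p + 1 < n) :
    (∀ i, MemLp (fun w : (Fin n → Cov p) × Cov p => weight w.1 w.2 i) 2
      ((Measure.pi fun _ => stdGaussian (Cov p)).prod (stdGaussian (Cov p)))) ∧
    ∫ w : (Fin n → Cov p) × Cov p, ∑ i, weight w.1 w.2 i ^ 2
      ∂((Measure.pi fun _ => stdGaussian (Cov p)).prod (stdGaussian (Cov p))) =
      p / ((n : ℝ) - p - 1) := by
  set ρ := (Measure.pi fun _ : Fin n => stdGaussian (Cov p))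
  have h2 : MemLp id 2 (gaussianReal 0 1) := IsGaussian.memLp_two_id
  have h0 : ∫ x, x ∂(gaussianReal 0 1) = 0 := integral_id_gaussianReal
  have h1 : ∫ x, x ^ 2 ∂(gaussianReal 0 1) = 1 := by
    have := variance_of_integral_eq_zero (μ := gaussianReal 0 1) (X := id) aemeasurable_id h0
    rw [variance_id_gaussianReal] at this
    simpa using this.symm
  have hsplit : MeasurePreserving (fun w : (Fin n → Cov p) × Cov p => (w.1, w.2.ofLp))
      (ρ.prod (stdGaussian (Cov p))) (ρ.prod (Measure.pi fun _ => gaussianReal 0 1)) := by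
    refine ⟨by fun_prop, ?_⟩
    rw [← map_pi_eq_stdGaussian]
    change Measure.map (Prod.map id WithLp.ofLp) _ = _
    rw [← Measure.map_prod_map _ _ measurable_id (by fun_prop), Measure.map_id,
      Measure.map_map (by fun_prop) (by fun_prop)]
    simp [Function.comp_def]
  -- Here the coordinates of the test covariate play the role of the noise, with variance 1, and row
  -- `i` of XG⁻¹ gives the coefficients.
  have key := fun i => integral_sq_sum_mul_noise h2 h0
    (fun j => memLp_mul_gram_inv_stdGaussian hnp i j)
  have hint : ∀ i, Integrable (fun w : (Fin n → Cov p) × Cov p => weight w.1 w.2 i ^ 2)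
      (ρ.prod (stdGaussian (Cov p))) := fun i => by
    simp_rw [weight_apply]
    exact hsplit.integrable_comp_of_integrable (key i).1
  refine ⟨fun i => ?_, ?_⟩
  · rw [memLp_two_iff_integrable_sq (measurable_weight i).aestronglyMeasurable]
    exact hint i
  · rw [integral_finsetSum _ fun i _ => hint i]
    have hi : ∀ i, ∫ w : (Fin n → Cov p) × Cov p, weight w.1 w.2 i ^ 2
        ∂(ρ.prod (stdGaussian (Cov p))) =
        ∑ j, ∫ xs, (covMatrix xs * ((covMatrix xs)ᵀ * covMatrix xs)⁻¹) i j ^ 2 ∂ρ := fun i => by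
      rw [← integral_finsetSum _ fun j _ => (memLp_mul_gram_inv_stdGaussian hnp i j).integrable_sq,
        ← one_mul (∫ xs, ∑ j, _ ∂ρ), ← h1, ← (key i).2, ← hsplit.map_eq,
        integral_map hsplit.measurable.aemeasurable
          (by rw [hsplit.map_eq]; exact (key i).1.aestronglyMeasurable)]
      simp_rw [weight_apply]
    simp_rw [hi]
    rw [Finset.sum_comm]
    have hj : ∀ j, ∑ i, ∫ xs, (covMatrix xs * ((covMatrix xs)ᵀ * covMatrix xs)⁻¹) i j ^ 2 ∂ρ =
        1 / ((n : ℝ) - p - 1) := fun j => by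
      rw [← integral_finsetSum _ fun i _ => (memLp_mul_gram_inv_stdGaussian hnp i j).integrable_sq,
        ← (integrable_gram_inv_stdGaussian hnp j).2]
      refine integral_congr_ae ?_
      filter_upwards [ae_isUnit_gram_stdGaussian hnp] with xs hxs
      exact sum_sq_mul_gram_inv hxs j
    simp_rw [hj]
    simp [div_eq_mul_inv]

end Standard

/-! ### Reduction of a general covariance to the identity. -/

section Whitening

variable {n p : ℕ} {S : Matrix (Fin p) (Fin p) ℝ}

lemma covMatrix_linear (R : Matrix (Fin p) (Fin p) ℝ) (zs : Fin n → Cov p) :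
    covMatrix (fun i => Matrix.toEuclideanCLM (𝕜 := ℝ) R (zs i)) = covMatrix zs * Rᵀ := by
  ext i j
  simp [covMatrix, Matrix.mul_apply, Matrix.ofLp_toEuclideanCLM, Matrix.mulVec, dotProduct, mul_comm]

lemma gram_covMatrix_linear (R : Matrix (Fin p) (Fin p) ℝ) (zs : Fin n → Cov p) :
    (covMatrix zs * Rᵀ)ᵀ * (covMatrix zs * Rᵀ) = R * ((covMatrix zs)ᵀ * covMatrix zs) * Rᵀ := by
  simp only [Matrix.transpose_mul, Matrix.transpose_transpose, Matrix.mul_assoc]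

/-- The factors of R cancel: Rᵀ(RGRᵀ)⁻¹R = G⁻¹. Invertibility of G is not needed. -/
lemma weight_linear {R : Matrix (Fin p) (Fin p) ℝ} (hR : IsUnit R) (zs : Fin n → Cov p)
    (z : Cov p) :
    weight (fun i => Matrix.toEuclideanCLM (𝕜 := ℝ) R (zs i))
      (Matrix.toEuclideanCLM (𝕜 := ℝ) R z) = weight zs z := by
  have h1 := (Matrix.isUnit_iff_isUnit_det _).1 hR
  have h2 : IsUnit Rᵀ.det := by rwa [Matrix.det_transpose]
  simp only [weight, covMatrix_linear, gram_covMatrix_linear, Matrix.ofLp_toEuclideanCLM,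
    Matrix.mulVec_mulVec, Matrix.mul_inv_rev]
  congr 1
  simp only [Matrix.mul_assoc, Matrix.nonsing_inv_mul _ h1, Matrix.mul_one]
  rw [← Matrix.mul_assoc Rᵀ, Matrix.mul_nonsing_inv _ h2, Matrix.one_mul]

lemma exists_measurePreserving_multivariateGaussian (hS : S.PosSemidef) (hS' : IsUnit S) :
    ∃ R : Matrix (Fin p) (Fin p) ℝ, IsUnit R ∧
      MeasurePreserving (Matrix.toEuclideanCLM (𝕜 := ℝ) R) (stdGaussian (Cov p))
        (multivariateGaussian 0 S) := by
  open scoped MatrixOrder in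
  refine ⟨CFC.sqrt S, (CFC.isUnit_sqrt_iff S hS.nonneg).2 hS', by fun_prop, ?_⟩
  simp [multivariateGaussian]

lemma weight_multivariateGaussian (hnp : p + 1 < n) (hS : S.PosSemidef) (hS' : IsUnit S) :
    (∀ i, MemLp (fun w : (Fin n → Cov p) × Cov p => weight w.1 w.2 i) 2
      ((Measure.pi fun _ => multivariateGaussian 0 S).prod (multivariateGaussian 0 S))) ∧
    ∫ w : (Fin n → Cov p) × Cov p, ∑ i, weight w.1 w.2 i ^ 2
      ∂((Measure.pi fun _ => multivariateGaussian 0 S).prod (multivariateGaussian 0 S)) =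
      p / ((n : ℝ) - p - 1) := by
  obtain ⟨R, hR, hmp⟩ := exists_measurePreserving_multivariateGaussian hS hS'
  have hpi := (measurePreserving_pi (fun _ : Fin n => stdGaussian (Cov p))
    (fun _ => multivariateGaussian 0 S) fun _ => hmp).prod hmp
  obtain ⟨h1, h2⟩ := weight_stdGaussian hnp
  have hm : ∀ i, Measurable fun w : (Fin n → Cov p) × Cov p => weight w.1 w.2 i :=
    fun i => measurable_weight i
  constructor
  · intro i
    rw [← hpi.map_eq, memLp_map_measure_iff (hm i).aestronglyMeasurable hpi.measurable.aemeasurable]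
    convert h1 i using 2 with w
    exact congrFun (weight_linear hR w.1 w.2) i
  · rw [← hpi.map_eq, integral_map hpi.measurable.aemeasurable
      (Finset.measurable_sum _ fun i _ => (hm i).pow_const 2).aestronglyMeasurable, ← h2]
    congr 1 with w
    exact Finset.sum_congr rfl fun i _ => by
      rw [← weight_linear hR w.1 w.2]; rfl

lemma ae_isUnit_gram_multivariateGaussian (hnp : p + 1 < n) (hS : S.PosSemidef) (hS' : IsUnit S) :
    ∀ᵐ xs : Fin n → Cov p ∂(Measure.pi fun _ => multivariateGaussian 0 S),
      IsUnit ((covMatrix xs)ᵀ * covMatrix xs) := by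
  obtain ⟨R, hR, hmp⟩ := exists_measurePreserving_multivariateGaussian hS hS'
  have hpi := measurePreserving_pi (fun _ : Fin n => stdGaussian (Cov p))
    (fun _ => multivariateGaussian 0 S) fun _ => hmp
  -- Invertibility of G is linear independence of the columns, an open condition.
  have hms : MeasurableSet {xs : Fin n → Cov p | IsUnit ((covMatrix xs)ᵀ * covMatrix xs)} := by
    have : {xs : Fin n → Cov p | IsUnit ((covMatrix xs)ᵀ * covMatrix xs)} =
        columns ⁻¹' {z | LinearIndependent ℝ z} := by
      ext xs
      rw [Set.mem_preimage, Set.mem_ofPred_eq, Set.mem_ofPred_eq, ← gram_columns,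
        ← Matrix.det_gram_ne_zero_iff_linearIndependent (𝕜 := ℝ), Matrix.isUnit_iff_isUnit_det,
        isUnit_iff_ne_zero]
    rw [this]
    exact (measurePreserving_columns n p).measurable
      isOpen_setOfPred_linearIndependent.measurableSet
  rw [← hpi.map_eq, ae_map_iff hpi.measurable.aemeasurable hms]
  filter_upwards [ae_isUnit_gram_stdGaussian hnp] with zs hzs
  rw [covMatrix_linear, gram_covMatrix_linear]
  exact (hR.mul hzs).mul ((Matrix.isUnit_transpose R).2 hR)

end Whitening

/-! ### Rearranging product measures. -/

section ProductLaws

lemma measurePreserving_prodProdProdComm {A B C D : Type*} [MeasurableSpace A] [MeasurableSpace B]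
    [MeasurableSpace C] [MeasurableSpace D] (a : Measure A) (b : Measure B) (c : Measure C)
    (d : Measure D) [SFinite a] [SFinite b] [SFinite c] [SFinite d] :
    MeasurePreserving (fun q : (A × B) × (C × D) => ((q.1.1, q.2.1), (q.1.2, q.2.2)))
      ((a.prod b).prod (c.prod d)) ((a.prod c).prod (b.prod d)) := by
  refine ⟨by fun_prop, Measure.ext_of_lintegral _ fun g hg => ?_⟩
  rw [lintegral_map hg (by fun_prop), lintegral_prod _ (by fun_prop),
    lintegral_prod _ (by fun_prop), lintegral_prod _ (by fun_prop), lintegral_prod _ (by fun_prop)]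
  refine lintegral_congr fun x => ?_
  have h1 : ∀ y, ∫⁻ z, g ((x, z.1), (y, z.2)) ∂(c.prod d) =
      ∫⁻ u, ∫⁻ v, g ((x, u), (y, v)) ∂d ∂c := fun y => lintegral_prod _ (by fun_prop)
  have h2 : ∀ u, ∫⁻ z, g ((x, u), z) ∂(b.prod d) = ∫⁻ y, ∫⁻ v, g ((x, u), (y, v)) ∂d ∂b :=
    fun u => lintegral_prod _ (by fun_prop)
  simp_rw [h1, h2]
  exact lintegral_lintegral_swap (by fun_prop)

/-- The noise vector of the training responses, together with one further noise variable. -/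
def consNoise {ι : Type*} (q : (ι → ℝ) × ℝ) : Option ι → ℝ := fun o => o.elim q.2 q.1

lemma measurePreserving_consNoise {ι : Type*} [Fintype ι] (ν : Measure ℝ) [SigmaFinite ν] :
    MeasurePreserving (consNoise (ι := ι)) ((Measure.pi fun _ => ν).prod ν)
      (Measure.pi fun _ => ν) := by
  have h : (consNoise (ι := ι)) = (MeasurableEquiv.piOptionEquivProd fun _ : Option ι => ℝ).symm := by
    funext q o
    cases o <;> rfl
  rw [h]
  exact ⟨MeasurableEquiv.measurable _, Measure.pi_map_piOptionEquivProd (fun _ : Option ι => ν)⟩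

end ProductLaws

/-! ### Separating covariates from noise. -/

section Noise

variable {n p : ℕ} {P : Measure (Cov p × ℝ)} {f : Cov p → ℝ} {σ : ℝ}

lemma SignalPlusNoise.measurable_error (hP : SignalPlusNoise P f σ) :
    Measurable fun z : Cov p × ℝ => z.2 - f z.1 :=
  measurable_snd.sub (hP.measurable_regression.comp measurable_fst)

/-- The law of the error `y - f(x)`. -/
noncomputable def errorLaw (P : Measure (Cov p × ℝ)) (f : Cov p → ℝ) : Measure ℝ :=
  P.map fun z => z.2 - f z.1

lemma SignalPlusNoise.memLp_errorLaw (hP : SignalPlusNoise P f σ) :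
    MemLp id 2 (errorLaw P f) := by
  rw [errorLaw, memLp_map_measure_iff (by fun_prop) hP.measurable_error.aemeasurable]
  exact hP.memLp_error

variable [IsProbabilityMeasure P]

lemma SignalPlusNoise.isProbabilityMeasure_errorLaw (hP : SignalPlusNoise P f σ) :
    IsProbabilityMeasure (errorLaw P f) :=
  Measure.isProbabilityMeasure_map hP.measurable_error.aemeasurable

lemma SignalPlusNoise.integral_errorLaw (hP : SignalPlusNoise P f σ) :
    ∫ x, x ∂(errorLaw P f) = 0 := by
  have hle : MeasurableSpace.comap Prod.fst inferInstance ≤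
      (inferInstance : MeasurableSpace (Cov p × ℝ)) := measurable_fst.comap_le
  rw [errorLaw, integral_map hP.measurable_error.aemeasurable (by fun_prop),
    integral_sub hP.integrable_response (integrable_condExp.congr hP.condExp_response),
    ← integral_congr_ae hP.condExp_response, integral_condExp hle, sub_self]

lemma SignalPlusNoise.integral_sq_errorLaw (hP : SignalPlusNoise P f σ) :
    ∫ x, x ^ 2 ∂(errorLaw P f) = σ ^ 2 := by
  have hle : MeasurableSpace.comap Prod.fst inferInstance ≤
      (inferInstance : MeasurableSpace (Cov p × ℝ)) := measurable_fst.comap_le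
  have h := integral_congr_ae hP.condVar_response
  -- The conditional variance is the conditional mean of (y - E(y|x))², so the tower property gives
  -- its mean.
  rw [condVar, integral_condExp hle, integral_const, probReal_univ, one_smul] at h
  rw [errorLaw, integral_map hP.measurable_error.aemeasurable (by fun_prop), ← h]
  refine integral_congr_ae ?_
  filter_upwards [hP.condExp_response] with z hz
  simp [hz]

lemma SignalPlusNoise.measurePreserving_pair (hP : SignalPlusNoise P f σ) :
    MeasurePreserving (fun z : Cov p × ℝ => (z.1, z.2 - f z.1)) P
      (P.fst.prod (errorLaw P f)) := by
  have hm := hP.measurable_error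
  exact ⟨by fun_prop, (indepFun_iff_map_prod_eq_prod_map_map measurable_fst.aemeasurable
    hm.aemeasurable).1 hP.indep_error.symm⟩

/-- The conditional law of the response given the covariates. -/
noncomputable def responseKernel (ν : Measure ℝ) (f : Cov p → ℝ) : Kernel (Cov p) ℝ :=
  (Kernel.id ×ₖ Kernel.const _ ν).map fun q => f q.1 + q.2

lemma lintegral_responseKernel {ν : Measure ℝ} [IsProbabilityMeasure ν] (hf : Measurable f)
    (x : Cov p) {g : ℝ → ENNReal} (hg : Measurable g) :
    ∫⁻ y, g y ∂(responseKernel ν f x) = ∫⁻ e, g (f x + e) ∂ν := by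
  have hm : Measurable fun q : Cov p × ℝ => f q.1 + q.2 := by fun_prop
  rw [responseKernel, Kernel.map_apply _ hm, lintegral_map hg hm, Kernel.prod_apply,
    lintegral_prod _ (by fun_prop), Kernel.id_apply, lintegral_dirac' _ (by fun_prop),
    Kernel.const_apply]

instance {ν : Measure ℝ} [IsProbabilityMeasure ν] : IsFiniteKernel (responseKernel ν f) := by
  unfold responseKernel; infer_instance

lemma SignalPlusNoise.eq_compProd_responseKernel (hP : SignalPlusNoise P f σ) :
    P = P.fst ⊗ₘ responseKernel (errorLaw P f) f := by
  have := hP.isProbabilityMeasure_errorLaw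
  have hf := hP.measurable_regression
  refine Measure.ext_of_lintegral _ fun g hg => ?_
  rw [Measure.lintegral_compProd hg]
  have h1 : ∀ x, ∫⁻ y, g (x, y) ∂(responseKernel (errorLaw P f) f x) =
      ∫⁻ e, g (x, f x + e) ∂(errorLaw P f) := fun x =>
    lintegral_responseKernel hf x (hg.comp measurable_prodMk_left)
  simp_rw [h1]
  have h := lintegral_prod (μ := P.fst) (ν := errorLaw P f) (fun w => g (w.1, f w.1 + w.2))
    (by fun_prop)
  rw [← h, ← hP.measurePreserving_pair.lintegral_comp (by fun_prop)]
  simp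

/-- By uniqueness of disintegration, `P.condKernel` at almost every x is the law of f(x) + ε. The
copy therefore carries a fresh error, independent of the covariate and of the original error. -/
lemma SignalPlusNoise.measurePreserving_copy (hP : SignalPlusNoise P f σ) :
    MeasurePreserving (fun w : (Cov p × ℝ) × ℝ => (w.1.1, (w.1.2 - f w.1.1, w.2 - f w.1.1)))
      (copyLaw P) (P.fst.prod ((errorLaw P f).prod (errorLaw P f))) := by
  have := hP.isProbabilityMeasure_errorLaw
  have hf := hP.measurable_regression
  set ν := errorLaw P f
  have hκ := hP.eq_compProd_responseKernel
  have hcond := eq_condKernel_of_measure_eq_compProd (ρ := P) (responseKernel ν f) hκ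
  refine ⟨by fun_prop, Measure.ext_of_lintegral _ fun g hg => ?_⟩
  rw [lintegral_map hg (by fun_prop), copyLaw, Measure.lintegral_compProd (by fun_prop)]
  simp only [Kernel.comap_apply]
  have hG : Measurable fun z : Cov p × ℝ =>
      ∫⁻ y, g (z.1, (z.2 - f z.1, y - f z.1)) ∂(P.condKernel z.1) := by
    have : Measurable fun w : (Cov p × ℝ) × ℝ => g (w.1.1, (w.1.2 - f w.1.1, w.2 - f w.1.1)) := by
      fun_prop
    exact this.lintegral_kernel_prod_right' (κ := P.condKernel.comap Prod.fst measurable_fst)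
  calc ∫⁻ z, ∫⁻ y, g (z.1, (z.2 - f z.1, y - f z.1)) ∂(P.condKernel z.1) ∂P
      = ∫⁻ z, ∫⁻ y, g (z.1, (z.2 - f z.1, y - f z.1)) ∂(P.condKernel z.1)
          ∂(P.fst ⊗ₘ responseKernel ν f) := by rw [← hκ]
    _ = ∫⁻ x, ∫⁻ y', ∫⁻ y, g (x, (y' - f x, y - f x)) ∂(P.condKernel x) ∂(responseKernel ν f x)
          ∂P.fst := Measure.lintegral_compProd hG
    _ = ∫⁻ x, ∫⁻ e, ∫⁻ e', g (x, (e, e')) ∂ν ∂ν ∂P.fst := by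
        refine lintegral_congr_ae ?_
        filter_upwards [hcond] with x hx
        rw [← hx]
        have h1 : ∀ y', ∫⁻ y, g (x, (y' - f x, y - f x)) ∂(responseKernel ν f x) =
            ∫⁻ e', g (x, (y' - f x, e')) ∂ν := fun y' => by
          rw [lintegral_responseKernel hf x (g := fun y => g (x, (y' - f x, y - f x)))
            (by fun_prop)]
          simp
        simp_rw [h1]
        rw [lintegral_responseKernel hf x (g := fun y' => ∫⁻ e', g (x, (y' - f x, e')) ∂ν)
          (Measurable.lintegral_prod_right' (f := fun w : ℝ × ℝ => g (x, (w.1 - f x, w.2)))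
            (by fun_prop))]
        simp
    _ = ∫⁻ x, ∫⁻ w, g (x, w) ∂(ν.prod ν) ∂P.fst := by
        refine lintegral_congr fun x => ?_
        rw [lintegral_prod _ (by fun_prop)]
    _ = ∫⁻ w, g w ∂(P.fst.prod (ν.prod ν)) := (lintegral_prod _ (by fun_prop)).symm

instance isProbabilityMeasure_trainLaw : IsProbabilityMeasure (trainLaw n P) := by
  unfold trainLaw; infer_instance

instance isProbabilityMeasure_copyLaw : IsProbabilityMeasure (copyLaw P) := by
  unfold copyLaw; infer_instance

lemma measurePreserving_fst_copyLaw : MeasurePreserving Prod.fst (copyLaw P) P :=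
  ⟨measurable_fst, Measure.fst_compProd _ _⟩

lemma measurePreserving_sameXLaw_trainLaw :
    MeasurePreserving (fun (w : Fin n → (Cov p × ℝ) × ℝ) k => (w k).1) (sameXLaw n P)
      (trainLaw n P) :=
  measurePreserving_pi _ _ fun _ => measurePreserving_fst_copyLaw

lemma SignalPlusNoise.measurePreserving_train (hP : SignalPlusNoise P f σ) :
    MeasurePreserving (fun D : Data n p => (fun i => (D i).1, fun i => (D i).2 - f (D i).1))
      (trainLaw n P) ((Measure.pi fun _ => P.fst).prod (Measure.pi fun _ => errorLaw P f)) := by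
  have := hP.isProbabilityMeasure_errorLaw
  exact (measurePreserving_arrowProdEquivProdArrow (Cov p) ℝ (Fin n) (fun _ => P.fst)
    (fun _ => errorLaw P f)).comp (measurePreserving_pi _ _ fun _ => hP.measurePreserving_pair)

lemma SignalPlusNoise.measurePreserving_trainTest (hP : SignalPlusNoise P f σ) :
    MeasurePreserving (fun w : Data n p × (Cov p × ℝ) => ((fun i => (w.1 i).1, w.2.1),
        consNoise (fun i => (w.1 i).2 - f (w.1 i).1, w.2.2 - f w.2.1)))
      (trainTestLaw n P)
      (((Measure.pi fun _ => P.fst).prod P.fst).prod (Measure.pi fun _ => errorLaw P f)) := by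
  have := hP.isProbabilityMeasure_errorLaw
  exact ((MeasurePreserving.id _).prod (measurePreserving_consNoise (errorLaw P f))).comp
    ((measurePreserving_prodProdProdComm _ _ _ _).comp
      (hP.measurePreserving_train.prod hP.measurePreserving_pair))

/-- Each summand of OptS involves a single copy, so only the `i`-th fresh error is kept, giving `n +
1` errors as in the test setting. -/
lemma SignalPlusNoise.measurePreserving_sameX (hP : SignalPlusNoise P f σ) (i : Fin n) :
    MeasurePreserving (fun w : Fin n → (Cov p × ℝ) × ℝ => (fun k => (w k).1.1,
        consNoise (fun k => (w k).1.2 - f (w k).1.1, (w i).2 - f (w i).1.1)))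
      (sameXLaw n P)
      ((Measure.pi fun _ => P.fst).prod (Measure.pi fun _ => errorLaw P f)) := by
  have := hP.isProbabilityMeasure_errorLaw
  set ν := errorLaw P f
  have h1 := (measurePreserving_arrowProdEquivProdArrow (Cov p) (ℝ × ℝ) (Fin n) (fun _ => P.fst)
    (fun _ => ν.prod ν)).comp (measurePreserving_pi _ _ fun _ => hP.measurePreserving_copy)
  have h2 := measurePreserving_arrowProdEquivProdArrow ℝ ℝ (Fin n) (fun _ => ν) (fun _ => ν)
  have h3 := ((MeasurePreserving.id (Measure.pi fun _ : Fin n => ν)).prod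
    (measurePreserving_eval (fun _ : Fin n => ν) i)).comp h2
  exact ((MeasurePreserving.id _).prod ((measurePreserving_consNoise ν).comp h3)).comp h1

end Noise

/-! ### Algebra of the weights and the hat matrix. -/

section HatMatrix

variable {n p : ℕ}

lemma leastSquares_eq_sum_weight (D : Data n p) (x : Cov p) :
    leastSquares D x = ∑ k, weight (fun i => (D i).1) x k * (D k).2 := by
  have hX : designMatrix D = covMatrix fun i => (D i).1 := rfl
  have hG : ((covMatrix fun i => (D i).1)ᵀ * covMatrix fun i => (D i).1)⁻¹ᵀ =
      ((covMatrix fun i => (D i).1)ᵀ * covMatrix fun i => (D i).1)⁻¹ := by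
    rw [Matrix.transpose_nonsing_inv, Matrix.transpose_mul, Matrix.transpose_transpose]
  change _ = weight (fun i => (D i).1) x ⬝ᵥ responses D
  rw [leastSquares, hX, weight, Matrix.dotProduct_mulVec, Matrix.dotProduct_mulVec,
    Matrix.vecMul_transpose, ← Matrix.mulVec_transpose, hG]

lemma sum_weight_mul_dotProduct {xs : Fin n → Cov p}
    (h : IsUnit ((covMatrix xs)ᵀ * covMatrix xs)) (x : Cov p) (β : Fin p → ℝ) :
    ∑ k, weight xs x k * ((xs k).ofLp ⬝ᵥ β) = x.ofLp ⬝ᵥ β := by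
  have hG : ((covMatrix xs)ᵀ * covMatrix xs)⁻¹ᵀ = ((covMatrix xs)ᵀ * covMatrix xs)⁻¹ := by
    rw [Matrix.transpose_nonsing_inv, Matrix.transpose_mul, Matrix.transpose_transpose]
  change weight xs x ⬝ᵥ (covMatrix xs *ᵥ β) = _
  rw [weight, Matrix.dotProduct_mulVec, ← Matrix.mulVec_transpose, Matrix.mulVec_mulVec,
    Matrix.mulVec_mulVec, Matrix.mul_nonsing_inv _ ((Matrix.isUnit_iff_isUnit_det _).1 h),
    Matrix.one_mulVec]

lemma weight_train (xs : Fin n → Cov p) (i k : Fin n) :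
    weight xs (xs i) k =
      (covMatrix xs * ((covMatrix xs)ᵀ * covMatrix xs)⁻¹ * (covMatrix xs)ᵀ) k i := by
  rw [weight_apply, Matrix.mul_apply]
  rfl

lemma sum_sq_weight_train {xs : Fin n → Cov p} (h : IsUnit ((covMatrix xs)ᵀ * covMatrix xs))
    (i : Fin n) : ∑ k, weight xs (xs i) k ^ 2 = weight xs (xs i) i := by
  have hG : ((covMatrix xs)ᵀ * covMatrix xs)⁻¹ᵀ = ((covMatrix xs)ᵀ * covMatrix xs)⁻¹ := by
    rw [Matrix.transpose_nonsing_inv, Matrix.transpose_mul, Matrix.transpose_transpose]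
  simp_rw [weight_train]
  set X := covMatrix xs
  have hM : (X * (Xᵀ * X)⁻¹ * Xᵀ)ᵀ * (X * (Xᵀ * X)⁻¹ * Xᵀ) = X * (Xᵀ * X)⁻¹ * Xᵀ := by
    rw [Matrix.transpose_mul, Matrix.transpose_mul, Matrix.transpose_transpose, hG]
    simp only [Matrix.mul_assoc]
    rw [← Matrix.mul_assoc Xᵀ X, ← Matrix.mul_assoc (Xᵀ * X),
      Matrix.mul_nonsing_inv _ ((Matrix.isUnit_iff_isUnit_det _).1 h), Matrix.one_mul]
  conv_rhs => rw [← hM, Matrix.mul_apply]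
  simp only [Matrix.transpose_apply, sq]

lemma sum_weight_train_self {xs : Fin n → Cov p} (h : IsUnit ((covMatrix xs)ᵀ * covMatrix xs)) :
    ∑ i, weight xs (xs i) i = p := by
  simp_rw [weight_train]
  change Matrix.trace _ = _
  rw [Matrix.trace_mul_comm, ← Matrix.mul_assoc,
    Matrix.mul_nonsing_inv _ ((Matrix.isUnit_iff_isUnit_det _).1 h), Matrix.trace_one,
    Fintype.card_fin]

/-- Idempotence gives Hᵢₖ² ≤ Hᵢᵢ; k = i yields Hᵢᵢ ≤ 1. This bound makes the in-sample weights
integrable without Gaussianity. -/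
lemma abs_weight_train_le_one {xs : Fin n → Cov p}
    (h : IsUnit ((covMatrix xs)ᵀ * covMatrix xs)) (i k : Fin n) :
    |weight xs (xs i) k| ≤ 1 := by
  have hle : ∀ k, weight xs (xs i) k ^ 2 ≤ weight xs (xs i) i := fun k => by
    rw [← sum_sq_weight_train h i]
    exact Finset.single_le_sum (f := fun k => weight xs (xs i) k ^ 2) (fun _ _ => sq_nonneg _)
      (Finset.mem_univ k)
  have h1 : weight xs (xs i) i ≤ 1 := by nlinarith [hle i]
  rw [← sq_le_one_iff_abs_le_one]
  exact (hle k).trans h1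

lemma weight_comp_perm (xs : Fin n → Cov p) (τ : Equiv.Perm (Fin n)) (x : Cov p) (i : Fin n) :
    weight (xs ∘ τ) x i = weight xs x (τ i) := by
  have hX : covMatrix (xs ∘ τ) = (covMatrix xs).submatrix τ id := rfl
  have hG : ((covMatrix xs).submatrix τ id)ᵀ * (covMatrix xs).submatrix τ id =
      (covMatrix xs)ᵀ * covMatrix xs := by
    rw [Matrix.transpose_submatrix, Matrix.submatrix_mul_equiv, Matrix.submatrix_id_id]
  rw [weight, hX, hG]
  rfl

end HatMatrix

/-! ### Mean squared residuals and prediction errors. -/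

section SecondMoments

variable {n p : ℕ}

lemma integrable_and_integral_of_ae_eq_sq_sum_noise {Ω 𝓦 ι : Type*} [MeasurableSpace Ω]
    [MeasurableSpace 𝓦] [Fintype ι] {μ : Measure Ω} {ρ : Measure 𝓦} [SFinite ρ] {ν : Measure ℝ}
    [IsProbabilityMeasure ν] (h2 : MemLp id 2 ν) (h0 : ∫ x, x ∂ν = 0) {c : ι → 𝓦 → ℝ}
    (hc : ∀ i, MemLp (c i) 2 ρ) {φ : Ω → 𝓦 × (ι → ℝ)}
    (hφ : MeasurePreserving φ μ (ρ.prod (Measure.pi fun _ => ν))) {g : Ω → ℝ}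
    (hg : g =ᵐ[μ] fun ω => (∑ i, c i (φ ω).1 * (φ ω).2 i) ^ 2) :
    Integrable g μ ∧ ∫ ω, g ω ∂μ = (∫ x, x ^ 2 ∂ν) * ∫ w, ∑ i, c i w ^ 2 ∂ρ := by
  obtain ⟨h, h'⟩ := integral_sq_sum_mul_noise h2 h0 hc
  refine ⟨(integrable_congr hg).2 (hφ.integrable_comp_of_integrable h), ?_⟩
  rw [integral_congr_ae hg, ← h', ← hφ.map_eq, integral_map hφ.measurable.aemeasurable
    (by rw [hφ.map_eq]; exact h.aestronglyMeasurable)]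

lemma measurable_weight_train (i k : Fin n) :
    Measurable fun xs : Fin n → Cov p => weight xs (xs i) k :=
  (measurable_weight k).comp (measurable_id.prodMk (measurable_pi_apply i))

lemma memLp_weight_train {ρ : Measure (Fin n → Cov p)} [IsFiniteMeasure ρ]
    (h : ∀ᵐ xs ∂ρ, IsUnit ((covMatrix xs)ᵀ * covMatrix xs)) (i k : Fin n) {q : ENNReal} :
    MemLp (fun xs : Fin n → Cov p => weight xs (xs i) k) q ρ := by
  refine MemLp.of_bound (measurable_weight_train i k).aestronglyMeasurable 1 ?_
  filter_upwards [h] with xs hxs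
  exact abs_weight_train_le_one hxs i k

/-- Each leverage has mean `p / n`, by exchangeability. -/
lemma integral_weight_train_self [NeZero n] {Q : Measure (Cov p)} [IsProbabilityMeasure Q]
    (h : ∀ᵐ xs : Fin n → Cov p ∂(Measure.pi fun _ => Q),
      IsUnit ((covMatrix xs)ᵀ * covMatrix xs)) (i : Fin n) :
    ∫ xs : Fin n → Cov p, weight xs (xs i) i ∂(Measure.pi fun _ => Q) = p / n := by
  have hsum : ∑ k, ∫ xs : Fin n → Cov p, weight xs (xs k) k ∂(Measure.pi fun _ => Q) = p := by
    rw [← integral_finsetSum _ fun k _ =>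
      (memLp_weight_train h k k (q := 1)).integrable le_rfl]
    rw [integral_congr_ae (g := fun _ => (p : ℝ)) (by
      filter_upwards [h] with xs hxs using sum_weight_train_self hxs)]
    simp
  have hperm : ∀ k, ∫ xs : Fin n → Cov p, weight xs (xs k) k ∂(Measure.pi fun _ => Q) =
      ∫ xs : Fin n → Cov p, weight xs (xs i) i ∂(Measure.pi fun _ => Q) := fun k => by
    set τ := Equiv.swap i k
    have hmp : MeasurePreserving (fun xs : Fin n → Cov p => xs ∘ τ) (Measure.pi fun _ => Q)
        (Measure.pi fun _ => Q) := by
      have h1 := measurePreserving_piCongrLeft (fun _ : Fin n => Q) τ.symm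
      convert h1 using 1
      funext xs j
      simp [MeasurableEquiv.piCongrLeft, Equiv.piCongrLeft_apply]
    conv_rhs => rw [← hmp.map_eq, integral_map hmp.measurable.aemeasurable
      (measurable_weight_train i i).aestronglyMeasurable]
    simp only [weight_comp_perm, Function.comp_apply, τ, Equiv.swap_apply_left]
  simp_rw [hperm] at hsum
  rw [Finset.sum_const, Finset.card_univ, Fintype.card_fin, nsmul_eq_mul] at hsum
  rw [eq_div_iff (Nat.cast_ne_zero.2 (NeZero.ne n)), mul_comm, hsum]

lemma sub_leastSquares_eq {f : Cov p → ℝ} {β : Fin p → ℝ} (hf : ∀ x, f x = x.ofLp ⬝ᵥ β)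
    {D : Data n p}
    (h : IsUnit ((covMatrix fun i => (D i).1)ᵀ * covMatrix fun i => (D i).1)) (x : Cov p)
    (y : ℝ) :
    y - leastSquares D x =
      (y - f x) - ∑ k, weight (fun i => (D i).1) x k * ((D k).2 - f (D k).1) := by
  simp_rw [mul_sub, Finset.sum_sub_distrib, leastSquares_eq_sum_weight, hf,
    sum_weight_mul_dotProduct h]
  ring

variable {P : Measure (Cov p × ℝ)} [IsProbabilityMeasure P] {f : Cov p → ℝ} {σ : ℝ}

lemma SignalPlusNoise.sq_residual (hP : SignalPlusNoise P f σ) [NeZero n] {β : Fin p → ℝ}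
    (hf : ∀ x, f x = x.ofLp ⬝ᵥ β)
    (hX : ∀ᵐ xs : Fin n → Cov p ∂(Measure.pi fun _ => P.fst),
      IsUnit ((covMatrix xs)ᵀ * covMatrix xs)) (i : Fin n) :
    Integrable (fun D : Data n p => ((D i).2 - leastSquares D (D i).1) ^ 2) (trainLaw n P) ∧
    ∫ D : Data n p, ((D i).2 - leastSquares D (D i).1) ^ 2 ∂(trainLaw n P) =
      σ ^ 2 * (1 - p / n) := by
  have := hP.isProbabilityMeasure_errorLaw
  have hφ := hP.measurePreserving_train (n := n)
  -- The coefficients are row `i` of I - H, whose squares sum to 1 - 2Hᵢᵢ + Hᵢᵢ = 1 - Hᵢᵢ.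
  have hc : ∀ k, MemLp (fun xs : Fin n → Cov p => (if k = i then 1 else 0) - weight xs (xs i) k) 2
      (Measure.pi fun _ => P.fst) := fun k =>
    (memLp_const _).sub (memLp_weight_train hX i k)
  have hX' := (measurePreserving_fst.comp hφ).quasiMeasurePreserving.ae hX
  have hg : (fun D : Data n p => ((D i).2 - leastSquares D (D i).1) ^ 2) =ᵐ[trainLaw n P]
      fun D => (∑ k, ((if k = i then 1 else 0) - weight (fun j => (D j).1) (D i).1 k) *
        ((D k).2 - f (D k).1)) ^ 2 := by
    filter_upwards [hX'] with D hD
    rw [sub_leastSquares_eq hf hD]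
    simp [sub_mul, Finset.sum_sub_distrib]
  obtain ⟨h1, h2⟩ := integrable_and_integral_of_ae_eq_sq_sum_noise hP.memLp_errorLaw
    hP.integral_errorLaw hc hφ hg
  refine ⟨h1, ?_⟩
  rw [h2, hP.integral_sq_errorLaw, ← integral_weight_train_self hX i]
  congr 1
  have hint := (memLp_weight_train hX i i (q := 1)).integrable le_rfl
  rw [← show ∫ _ : Fin n → Cov p, (1 : ℝ) ∂(Measure.pi fun _ => P.fst) = 1 by simp,
    ← integral_sub (integrable_const _) hint]
  refine integral_congr_ae ?_
  filter_upwards [hX] with xs hxs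
  simp only [sub_sq, Finset.sum_add_distrib, Finset.sum_sub_distrib, sum_sq_weight_train hxs]
  simp
  ring

lemma SignalPlusNoise.sq_copy (hP : SignalPlusNoise P f σ) [NeZero n] {β : Fin p → ℝ}
    (hf : ∀ x, f x = x.ofLp ⬝ᵥ β)
    (hX : ∀ᵐ xs : Fin n → Cov p ∂(Measure.pi fun _ => P.fst),
      IsUnit ((covMatrix xs)ᵀ * covMatrix xs)) (i : Fin n) :
    Integrable (fun w : Fin n → (Cov p × ℝ) × ℝ =>
      ((w i).2 - leastSquares (fun k => (w k).1) (w i).1.1) ^ 2) (sameXLaw n P) ∧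
    ∫ w : Fin n → (Cov p × ℝ) × ℝ, ((w i).2 - leastSquares (fun k => (w k).1) (w i).1.1) ^ 2
      ∂(sameXLaw n P) = σ ^ 2 * (1 + p / n) := by
  have := hP.isProbabilityMeasure_errorLaw
  have hφ := hP.measurePreserving_sameX i
  -- `none` indexes the fresh error. It is separate from the training errors, so there is no cross
  -- term and the squares sum to 1 + Hᵢᵢ.
  set c : Option (Fin n) → (Fin n → Cov p) → ℝ :=
    fun o xs => o.elim 1 fun k => -weight xs (xs i) k
  have hc : ∀ o, MemLp (c o) 2 (Measure.pi fun _ => P.fst) := by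
    rintro (_ | k)
    · exact memLp_const 1
    · exact (memLp_weight_train hX i k).neg
  have hX' := (measurePreserving_fst.comp hφ).quasiMeasurePreserving.ae hX
  have hg : (fun w : Fin n → (Cov p × ℝ) × ℝ =>
      ((w i).2 - leastSquares (fun k => (w k).1) (w i).1.1) ^ 2) =ᵐ[sameXLaw n P]
      fun w => (∑ o, c o (fun j => (w j).1.1) *
        consNoise (fun k => (w k).1.2 - f (w k).1.1, (w i).2 - f (w i).1.1) o) ^ 2 := by
    filter_upwards [hX'] with w hw
    rw [sub_leastSquares_eq hf (D := fun k => (w k).1) hw, Fintype.sum_option]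
    simp [c, consNoise, sub_eq_add_neg]
  obtain ⟨h1, h2⟩ := integrable_and_integral_of_ae_eq_sq_sum_noise hP.memLp_errorLaw
    hP.integral_errorLaw hc hφ hg
  refine ⟨h1, ?_⟩
  rw [h2, hP.integral_sq_errorLaw, ← integral_weight_train_self hX i]
  congr 1
  have hint := (memLp_weight_train hX i i (q := 1)).integrable le_rfl
  rw [← show ∫ _ : Fin n → Cov p, (1 : ℝ) ∂(Measure.pi fun _ => P.fst) = 1 by simp,
    ← integral_add (integrable_const _) hint]
  refine integral_congr_ae ?_
  filter_upwards [hX] with xs hxs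
  simp [Fintype.sum_option, c, sum_sq_weight_train hxs]

lemma SignalPlusNoise.testError_leastSquares (hP : SignalPlusNoise P f σ) {β : Fin p → ℝ}
    (hf : ∀ x, f x = x.ofLp ⬝ᵥ β)
    (hX : ∀ᵐ xs : Fin n → Cov p ∂(Measure.pi fun _ => P.fst),
      IsUnit ((covMatrix xs)ᵀ * covMatrix xs))
    (hw : ∀ k, MemLp (fun w : (Fin n → Cov p) × Cov p => weight w.1 w.2 k) 2
      ((Measure.pi fun _ => P.fst).prod P.fst)) :
    Integrable (testError leastSquares) (trainTestLaw n P) ∧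
    ∫ w, testError leastSquares w ∂(trainTestLaw n P) =
      σ ^ 2 * (1 + ∫ w : (Fin n → Cov p) × Cov p, ∑ k, weight w.1 w.2 k ^ 2
        ∂((Measure.pi fun _ => P.fst).prod P.fst)) := by
  have := hP.isProbabilityMeasure_errorLaw
  have hφ := hP.measurePreserving_trainTest (n := n)
  set c : Option (Fin n) → (Fin n → Cov p) × Cov p → ℝ :=
    fun o w => o.elim 1 fun k => -weight w.1 w.2 k
  have hc : ∀ o, MemLp (c o) 2 ((Measure.pi fun _ => P.fst).prod P.fst) := by
    rintro (_ | k)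
    · exact memLp_const 1
    · exact (hw k).neg
  have hX' := (measurePreserving_fst.comp
    (measurePreserving_fst.comp hφ)).quasiMeasurePreserving.ae hX
  have hg : testError leastSquares =ᵐ[trainTestLaw n P]
      fun w => (∑ o, c o (fun j => (w.1 j).1, w.2.1) *
        consNoise (fun k => (w.1 k).2 - f (w.1 k).1, w.2.2 - f w.2.1) o) ^ 2 := by
    filter_upwards [hX'] with w hw
    rw [testError, sub_leastSquares_eq hf (D := w.1) hw, Fintype.sum_option]
    simp [c, consNoise, sub_eq_add_neg]
  obtain ⟨h1, h2⟩ := integrable_and_integral_of_ae_eq_sq_sum_noise hP.memLp_errorLaw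
    hP.integral_errorLaw hc hφ hg
  refine ⟨h1, ?_⟩
  rw [h2, hP.integral_sq_errorLaw]
  congr 1
  rw [← show ∫ _, (1 : ℝ) ∂((Measure.pi fun _ : Fin n => P.fst).prod P.fst) = 1 by simp,
    ← integral_add (integrable_const _) (integrable_finsetSum _ fun k _ => (hw k).integrable_sq)]
  simp [Fintype.sum_option, c]

end SecondMoments

end RandomX

/-! ### Optimism and unbiasedness of RCp. -/

theorem mainTheorem4 (n p : ℕ) [NeZero n] (hnp : p + 1 < n)
    (P : MeasureTheory.Measure (RandomX.Cov p × ℝ)) [MeasureTheory.IsProbabilityMeasure P]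
    (S : Matrix (Fin p) (Fin p) ℝ) (hS : S.PosSemidef) (hS_inv : IsUnit S)
    (hQ : P.fst = ProbabilityTheory.multivariateGaussian 0 S)
    (f : RandomX.Cov p → ℝ) (σ : ℝ) (hP : RandomX.SignalPlusNoise P f σ)
    (β : Fin p → ℝ) (hf : ∀ x, f x = x.ofLp ⬝ᵥ β) :
    (MeasureTheory.Integrable (RandomX.optRIntegrand RandomX.leastSquares)
        (RandomX.trainTestLaw n P) ∧
      MeasureTheory.Integrable (RandomX.optSIntegrand RandomX.leastSquares)
        (RandomX.sameXLaw n P) ∧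
      RandomX.OptR (n := n) RandomX.leastSquares P =
        RandomX.OptS (n := n) RandomX.leastSquares P +
          σ ^ 2 * p / n * (((p : ℝ) + 1) / ((n : ℝ) - p - 1)) ∧
      RandomX.OptR (n := n) RandomX.leastSquares P =
        σ ^ 2 * p / n * (2 + ((p : ℝ) + 1) / ((n : ℝ) - p - 1))) ∧
    (MeasureTheory.Integrable (RandomX.RCp σ) (RandomX.trainLaw n P) ∧
      MeasureTheory.Integrable (RandomX.testError RandomX.leastSquares)
        (RandomX.trainTestLaw n P) ∧
      (∫ D, RandomX.RCp σ D ∂(RandomX.trainLaw n P)) =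
        RandomX.ErrR (n := n) RandomX.leastSquares P) := by

  have hX : ∀ᵐ xs : Fin n → RandomX.Cov p ∂(Measure.pi fun _ => P.fst),
      IsUnit ((RandomX.covMatrix xs)ᵀ * RandomX.covMatrix xs) := by
    rw [hQ]; exact RandomX.ae_isUnit_gram_multivariateGaussian hnp hS hS_inv
  obtain ⟨hw, hw'⟩ := RandomX.weight_multivariateGaussian (n := n) hnp hS hS_inv
  rw [← hQ] at hw hw'
  obtain ⟨hT, hT'⟩ := hP.testError_leastSquares hf hX hw
  rw [hw'] at hT'
  have hR := fun i => (hP.sq_residual hf hX i).1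
  have hR' := fun i => (hP.sq_residual hf hX i).2
  have hC := fun i => (hP.sq_copy hf hX i).1
  have hC' := fun i => (hP.sq_copy hf hX i).2
  have hn : (n : ℝ) ≠ 0 := Nat.cast_ne_zero.2 (NeZero.ne n)
  have hnp' : (n : ℝ) - p - 1 ≠ 0 := by
    have : (p : ℝ) + 1 < n := by exact_mod_cast hnp
    exact ne_of_gt (by linarith)
  have hfst : MeasurePreserving Prod.fst (RandomX.trainTestLaw n P) (RandomX.trainLaw n P) :=
    measurePreserving_fst
  have hsame := RandomX.measurePreserving_sameXLaw_trainLaw (n := n) (P := P)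
  have hR0 : Integrable (fun w => ((w.1 0).2 - RandomX.leastSquares w.1 (w.1 0).1) ^ 2)
      (RandomX.trainTestLaw n P) := hfst.integrable_comp_of_integrable (hR 0)
  have hR0' : ∫ w, ((w.1 0).2 - RandomX.leastSquares w.1 (w.1 0).1) ^ 2
      ∂(RandomX.trainTestLaw n P) = σ ^ 2 * (1 - p / n) := by
    rw [← hR' 0, ← hfst.map_eq, integral_map hfst.measurable.aemeasurable
      (by rw [hfst.map_eq]; exact (hR 0).aestronglyMeasurable)]
  have hRS : ∀ i, Integrable (fun w =>
      ((w i).1.2 - RandomX.leastSquares (fun k => (w k).1) (w i).1.1) ^ 2)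
      (RandomX.sameXLaw n P) := fun i => hsame.integrable_comp_of_integrable (hR i)
  have hRS' : ∀ i, ∫ w, ((w i).1.2 - RandomX.leastSquares (fun k => (w k).1) (w i).1.1) ^ 2
      ∂(RandomX.sameXLaw n P) = σ ^ 2 * (1 - p / n) := fun i => by
    rw [← hR' i, ← hsame.map_eq, integral_map hsame.measurable.aemeasurable
      (by rw [hsame.map_eq]; exact (hR i).aestronglyMeasurable)]
  have hRSS : Integrable (RandomX.RSS RandomX.leastSquares) (RandomX.trainLaw n P) :=
    integrable_finsetSum _ fun i _ => hR i
  have hOptR : RandomX.OptR (n := n) RandomX.leastSquares P =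
      σ ^ 2 * p / n * (2 + ((p : ℝ) + 1) / ((n : ℝ) - p - 1)) := by
    have h : RandomX.OptR (n := n) RandomX.leastSquares P =
        σ ^ 2 * (1 + p / ((n : ℝ) - p - 1)) - σ ^ 2 * (1 - p / n) := by
      rw [← hT', ← hR0', ← integral_sub hT hR0]
      rfl
    rw [h]
    field_simp
    ring
  have hOptS : RandomX.OptS (n := n) RandomX.leastSquares P = σ ^ 2 * p / n * 2 := by
    have h : RandomX.OptS (n := n) RandomX.leastSquares P =
        (1 / (n : ℝ)) * ∑ _i : Fin n, σ ^ 2 * (1 + p / (n : ℝ)) -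
          (1 / (n : ℝ)) * ∑ _i : Fin n, σ ^ 2 * (1 - p / (n : ℝ)) := by
      rw [← Finset.sum_congr rfl fun i _ => hC' i, ← Finset.sum_congr rfl fun i _ => hRS' i,
        ← integral_finsetSum _ fun i _ => hC i, ← integral_finsetSum _ fun i _ => hRS i,
        ← integral_const_mul, ← integral_const_mul,
        ← integral_sub ((integrable_finsetSum _ fun i _ => hC i).const_mul _)
          ((integrable_finsetSum _ fun i _ => hRS i).const_mul _)]
      rfl
    rw [h, Finset.sum_const, Finset.sum_const, Finset.card_univ, Fintype.card_fin, nsmul_eq_mul,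
      nsmul_eq_mul]
    field_simp
    ring
  refine ⟨⟨hT.sub hR0, ?_, ?_, hOptR⟩, (hRSS.div_const _).add (integrable_const _), hT, ?_⟩
  · exact ((integrable_finsetSum _ fun i _ => hC i).const_mul _).sub
      ((integrable_finsetSum _ fun i _ => hRS i).const_mul _)
  · rw [hOptR, hOptS]
    ring
  -- E RSS = σ²(n - p); adding the RCp penalty to its n-th part gives σ²(1 + p/(n - p - 1)).
  · have h : ∫ D, RandomX.RSS RandomX.leastSquares D ∂(RandomX.trainLaw n P) =
        n * (σ ^ 2 * (1 - p / n)) := by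
      simp only [RandomX.RSS]
      rw [integral_finsetSum _ fun i _ => hR i, Finset.sum_congr rfl fun i _ => hR' i]
      simp
    simp only [RandomX.RCp]
    rw [RandomX.ErrR, hT', integral_add (hRSS.div_const _) (integrable_const _),
      integral_div, h, integral_const, probReal_univ, one_smul]
    field_simp
    ring
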